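/- **Setting.** Let $N,K,L$ be positive integers with $L\le N$ and let $q$ be a prime. A server holds $N$ files $W_0,\dots,W_{N-1}$, independent and uniform on $\mathbb F_q^F$; write $\mathbf W=(W_0,\dots,W_{N-1})$. There are $K$ users; user $k$ demands $L$ distinct files, listed in its demand vector $\mathbf d_k=(d_{k,0},\dots,d_{k,L-1})$, and $\mathbf D=(\mathbf d_0,\dots,\mathbf d_{K-1})$. A scheme for file size $F$ consists of random variables $S_0,\dots,S_{K-1}$ (given to the respective users and known to the server) and $P$ (known only to the server) on finite alphabets, caching functions $\phi_k$ with values in $\mathbb F_q^{c}$, and encoding functions $\psi$ with values in $\mathbb F_q^{b}$ and $\mu$ with values in a finite set $\mathcal J$. User $k$ caches $Z_k=(\phi_k(S_k,P,\mathbf W),S_k)$ and the server broadcasts $X_{\mathbf D}=(\psi(\mathbf D,P,S,\mathbf W),\mu(\mathbf D,P,S))$, where $S=(S_0,\dots,S_{K-1})$. The variables $\mathbf d_0,\dots,\mathbf d_{K-1},P,S_0,\dots,S_{K-1},W_0,\dots,W_{N-1}$ are mutually independent, and entropies $H$ and mutual informations $I$ are taken with logarithms in base $q$. The scheme is *correct*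 if $H(W_{d_{k,0}},\dots,W_{d_{k,L-1}}\mid X_{\mathbf D},\mathbf d_k,Z_k)=0$ for every $k$, and *private* if $I\big((\mathbf d_i)_{i\ne k};\,X_{\mathbf D},Z_k,\mathbf d_k\big)=0$ for every $k$, both for all distributions of the independent demand vectors. A pair $(M,R)$ of real numbers is *achievable* for the $(N,K,L)$ demand-private coded caching problem if for every $\varepsilon>0$ and every sufficiently large $F$ there is a correct and private scheme for file size $F$ with $c\le(M+\varepsilon)F$, $b\le(R+\varepsilon)F$, $H(Z_k)\le(M+\varepsilon)F$ for every user $k$, $H(X_{\mathbf D})\le(R+\varepsilon)F$ for every fixed demand matrix $\mathbf D$, and such that the alphabet of each $S_k$ and the set $\mathcal J$ have at most $\varepsilon F$ elements. **Theorem.** Let $\bar N=\min\{N,KL\}$. The lower convex envelope of the points $$(M_r,R_r)=\left(\frac{\binom{K\bar N}{r}-\binom{K\bar N-L}{r}}{\binom{K\bar N}{r}}\,N,\ \frac{\binom{K\bar N}{r+1}-\binom{(K-1)\bar N}{r+1}}{\binom{K\bar N}{r}}\right),\qquad r=0,1,\dots,K\bar N,$$ is achievable: for every real $M\in[0,N]$,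 the pair $(M,R)$ with $R=\min\{R' : (M,R')\in\mathrm{conv}\{(M_r,R_r):0\le r\le K\bar N\}\}$ is achievable. -/

import Mathlib

/-! Discrete probability on finite types. A probability distribution on a finite type `α` is an
element of Mathlib's `stdSimplex ℝ α`, and `stdSimplex.map X p` is the law of the random variable
`X` under `p`. -/

namespace CodedCaching

noncomputable section

/-- The law of a pair of independent random variables with laws `p` and `r`. -/
def prodDist {α β : Type*} [Fintype α] [Fintype β] (p : stdSimplex ℝ α) (r : stdSimplex ℝ β) :
    stdSimplex ℝ (α × β) :=
  ⟨fun x => p x.1 * r x.2, fun x => mul_nonneg (p.2.1 x.1) (r.2.1 x.2), by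
    rw [Fintype.sum_prod_type]
    simp [← Finset.mul_sum]⟩

/-- The law of a finite family of mutually independent random variables with laws `p i`. -/
def piDist {ι : Type*} [Fintype ι] [DecidableEq ι] {α : ι → Type*} [∀ i, Fintype (α i)]
    (p : ∀ i, stdSimplex ℝ (α i)) : stdSimplex ℝ (∀ i, α i) :=
  ⟨fun x => ∏ i, p i (x i), fun x => Finset.prod_nonneg fun i _ => (p i).2.1 (x i), by
    have h := (Fintype.prod_sum (fun i a => p i a)).symm
    rw [h]
    simp⟩

/-- The uniform distribution on a nonempty finite type. -/
def uniformDist (α : Type*) [Fintype α] [Nonempty α] : stdSimplex ℝ α :=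
  ⟨fun _ => (Fintype.card α : ℝ)⁻¹, fun _ => by positivity, by simp⟩

section Entropy

variable {Ω α β : Type*} [Fintype Ω] [Fintype α] [Fintype β]

/-- Shannon entropy `H(X)`, with logarithms in base `q`, of a random variable `X` on the finite
probability space `(Ω, p)`. -/
def entropy (q : ℕ) (p : stdSimplex ℝ Ω) (X : Ω → α) : ℝ :=
  (∑ a, Real.negMulLog (stdSimplex.map X p a)) / Real.log q

/-- Conditional entropy `H(X | Y) = H(X, Y) - H(Y)`. -/
def condEntropy (q : ℕ) (p : stdSimplex ℝ Ω) (X : Ω → α) (Y : Ω → β) : ℝ :=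
  entropy q p (fun ω => (X ω, Y ω)) - entropy q p Y

/-- Mutual information `I(X; Y) = H(X) + H(Y) - H(X, Y)`. -/
def mutualInfo (q : ℕ) (p : stdSimplex ℝ Ω) (X : Ω → α) (Y : Ω → β) : ℝ :=
  entropy q p X + entropy q p Y - entropy q p (fun ω => (X ω, Y ω))

end Entropy

/-! The caching system. -/

/-- A file library: `N` files, each a vector of `F` symbols of the field with `q` elements. -/
abbrev Library (q N F : ℕ) : Type := Fin N → Fin F → ZMod q

/-- The demand vector of a single user: `L` pairwise distinct file indices. -/
abbrev Demand (N L : ℕ) : Type := Fin L ↪ Fin N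

/-- A demand matrix: one demand vector for each of the `K` users. -/
abbrev DemandMatrix (N K L : ℕ) : Type := Fin K → Demand N L

/-- Caching and encoding functions for `N` files of `F` symbols and `K` users that request `L`
distinct files each, with `c` cached symbols per user and `b` broadcast symbols. -/
structure Scheme (q N K L F c b : ℕ) where
  /-- The alphabet of the randomness given to user `k`. -/
  S : Fin K → Type
  /-- The alphabet of the randomness known only to the server. -/
  P : Type
  /-- The alphabet of the header of the broadcast message. -/
  J : Type
  [fintypeS : ∀ k, Fintype (S k)]
  [fintypeP : Fintype P]
  [fintypeJ : Fintype J]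
  /-- The distribution of the randomness given to user `k`. -/
  lawS : ∀ k, stdSimplex ℝ (S k)
  /-- The distribution of the randomness of the server. -/
  lawP : stdSimplex ℝ P
  /-- The caching functions; they do not see the demands. -/
  φ : ∀ k, S k → P → Library q N F → (Fin c → ZMod q)
  /-- The encoding function of the payload of the broadcast message. -/
  ψ : DemandMatrix N K L → P → (∀ k, S k) → Library q N F → (Fin b → ZMod q)
  /-- The encoding function of the header of the broadcast message; it does not see the files. -/
  μ : DemandMatrix N K L → P → (∀ k, S k) → J

attribute [instance] Scheme.fintypeS Scheme.fintypeP Scheme.fintypeJ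

namespace Scheme

variable {q N K L F c b : ℕ}

/-- The realizations of `(P, S, W)`. -/
abbrev Sample (𝒮 : Scheme q N K L F c b) : Type :=
  𝒮.P × (∀ k, 𝒮.S k) × Library q N F

/-- The cache content `Z_k` of user `k`. -/
def cache (𝒮 : Scheme q N K L F c b) (k : Fin K) (x : 𝒮.Sample) : (Fin c → ZMod q) × 𝒮.S k :=
  (𝒮.φ k (x.2.1 k) x.1 x.2.2, x.2.1 k)

/-- The broadcast message `X_D` for the demand matrix `D`. -/
def broadcast (𝒮 : Scheme q N K L F c b) (D : DemandMatrix N K L) (x : 𝒮.Sample) :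
    (Fin b → ZMod q) × 𝒮.J :=
  (𝒮.ψ D x.1 x.2.1 x.2.2, 𝒮.μ D x.1 x.2.1)

variable [NeZero q]

/-- The joint law of `(P, S, W)`: all independent, and the files uniform. -/
def law (𝒮 : Scheme q N K L F c b) : stdSimplex ℝ 𝒮.Sample :=
  prodDist 𝒮.lawP (prodDist (piDist 𝒮.lawS) (uniformDist (Library q N F)))

/-- The joint law of `(D, (P, S, W))` when the users' demand vectors are independent with laws
`δ k`, and independent of `(P, S, W)`. -/
def jointLaw (𝒮 : Scheme q N K L F c b) (δ : Fin K → stdSimplex ℝ (Demand N L)) :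
    stdSimplex ℝ (DemandMatrix N K L × 𝒮.Sample) :=
  prodDist (piDist δ) 𝒮.law

/-- Correctness: `H({W_{d_{k,l}} : l} | X_D, d_k, Z_k) = 0` for every user `k`, for all
distributions of the demands (in particular for each fixed demand matrix). -/
def Correct (𝒮 : Scheme q N K L F c b) : Prop :=
  ∀ (δ : Fin K → stdSimplex ℝ (Demand N L)) (k : Fin K),
    condEntropy q (𝒮.jointLaw δ)
      (fun ω => fun l : Fin L => ω.2.2.2 (ω.1 k l))
      (fun ω => (𝒮.broadcast ω.1 ω.2, ω.1 k, 𝒮.cache k ω.2)) = 0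

/-- Demand privacy: `I(D_{∖k}; X_D, Z_k, d_k) = 0` for every user `k`, for all distributions of
the (independent) demands. -/
def Private (𝒮 : Scheme q N K L F c b) : Prop :=
  ∀ (δ : Fin K → stdSimplex ℝ (Demand N L)) (k : Fin K),
    mutualInfo q (𝒮.jointLaw δ)
      (fun ω => fun i : {i : Fin K // i ≠ k} => ω.1 i)
      (fun ω => (𝒮.broadcast ω.1 ω.2, 𝒮.cache k ω.2, ω.1 k)) = 0

/-- The cache size is at most `M` and the rate at most `R` (normalized by the file size), in the
number of symbols as well as in entropy. -/
def HasCacheAndRate (𝒮 : Scheme q N K L F c b) (M R : ℝ) : Prop :=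
  (c : ℝ) ≤ M * F ∧ (b : ℝ) ≤ R * F ∧
    (∀ k, entropy q 𝒮.law (𝒮.cache k) / F ≤ M) ∧
    (∀ D, entropy q 𝒮.law (𝒮.broadcast D) / F ≤ R)

/-- The alphabets of the users' randomness and of the header have at most `ε * F` elements. -/
def HasSideInfo (𝒮 : Scheme q N K L F c b) (ε : ℝ) : Prop :=
  (∀ k, (Fintype.card (𝒮.S k) : ℝ) ≤ ε * F) ∧ (Fintype.card 𝒮.J : ℝ) ≤ ε * F

end Scheme

/-- The pair `(M, R)` is achievable for the `(N, K, L)` demand-private coded caching problem over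
the field with `q` elements: up to a vanishing fraction of the file size, cache size `M` and rate
`R` are attained by correct and private schemes with negligible side information, for all
sufficiently large file sizes `F`. -/
def Achievable (q N K L : ℕ) [NeZero q] (M R : ℝ) : Prop :=
  ∀ ε : ℝ, 0 < ε → ∃ F₀ : ℕ, ∀ F : ℕ, F₀ ≤ F →
    ∃ (c b : ℕ) (𝒮 : Scheme q N K L F c b),
      𝒮.Correct ∧ 𝒮.Private ∧ 𝒮.HasCacheAndRate (M + ε) (R + ε) ∧ 𝒮.HasSideInfo ε

/-- The lower convex envelope of a set of points of the plane, as a function of the abscissa. -/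
def lowerConvexEnvelope (A : Set (ℝ × ℝ)) (M : ℝ) : ℝ :=
  sInf {R : ℝ | (M, R) ∈ convexHull ℝ A}

/-- `min {N, KL}`. -/
def Nbar (N K L : ℕ) : ℕ := min N (K * L)

/-- The memory-rate pair with parameter `r`. -/
def memoryRatePoint (N K L r : ℕ) : ℝ × ℝ :=
  ((((K * Nbar N K L).choose r : ℝ) - ((K * Nbar N K L - L).choose r : ℝ)) /
      ((K * Nbar N K L).choose r : ℝ) * N,
   (((K * Nbar N K L).choose (r + 1) : ℝ) - (((K - 1) * Nbar N K L).choose (r + 1) : ℝ)) /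
      ((K * Nbar N K L).choose r : ℝ))

end

end CodedCaching

/-!
Each user `k` is replaced by `N̄` virtual users `(k, j)`, and a coded caching scheme without privacy
for the `K N̄` virtual users is made private by secret permutations.

*Privacy.* For each demand matrix the server fixes a set of `N̄` active files containing all demanded
ones, which exists as `N̄ = min N (K L)`. Files are known to the users only by labels that are
scrambled by a secret permutation `π` of the server. User `k` holds a secret permutation `σ k` of
the virtual positions, caches on behalf of the `L` virtual users `(k, σ k l)`, `l < L`, and the
header of the broadcast lists the labels demanded by all virtual users: those of each user run
through the labels of all active files, in an order chosen such that `(k, σ k l)` demands the `l`-th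
file of user `k`. Given what user `k` knows, the labels and the orders of the other users are
uniform. Concretely, for two demand matrices that agree at `k` there is a bijection of the secrets
and libraries that preserves the law and everything that user `k` sees
(`exists_private_scheme`), so the other demands are independent of it
(`mutualInfo_prodDist_piDist_eq_zero`).

*Delivery.* The file labelled `n` is an alternating `r`-form `Wₙ` on the space with basis `V`, the
virtual users; its coefficients, the subfiles, are indexed by the `r`-subsets of `V`. A receiver
stores the subfiles whose label meets its `L`-set of virtual users. If virtual user `v` demands
`d v`, let `eₙ` be the indicator one-form of `{v | d v = n}`. The message is the form
`Y = ∑ₙ eₙ ∧ Wₙ`. Evaluating it at `(v, t₁, …, tᵣ)` with `v` among its own virtual users, a receiver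
knows every term but `W_{d v}(t₁, …, tᵣ)` (`eq_zero_of_deliveryForm_eq_zero`). It suffices to send
the coefficients of `Y` at the `(r+1)`-sets that meet the `N̄` virtual users of one user, who
together demand all active files: as `Y` lies in the ideal generated by the `eₙ`, these determine
the others (`deliveryForm_eq_zero`). Counting subsets gives the memory-rate pair with parameter
`r`.

*Memory sharing.* A point of the convex hull is attained by splitting the files among the codes for
the various `r`, all run with the same secrets, so that the side information stays bounded while
the file size grows (`exists_code_of_mem_convexHull`).
-/

namespace CodedCaching

/-! ### Entropy and mutual information -/

section Information

variable {Ω α β : Type*} [Fintype Ω] [Fintype α] [Fintype β]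

open Classical in
lemma map_apply_eq_sum (p : stdSimplex ℝ Ω) (X : Ω → α) (a : α) :
    stdSimplex.map X p a = ∑ ω, if X ω = a then p ω else 0 := by
  rw [← Finset.sum_filter, stdSimplex.map_coe, FunOnFinite.linearMap_apply_apply]

lemma nonempty_of_stdSimplex (p : stdSimplex ℝ Ω) : Nonempty Ω := by
  by_contra h
  rw [not_nonempty_iff] at h
  simpa using p.2.2

lemma entropy_comp_injective (q : ℕ) (p : stdSimplex ℝ Ω) (X : Ω → α) {f : α → β}
    (hf : Function.Injective f) : entropy q p (fun ω => f (X ω)) = entropy q p X := by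
  classical
  unfold entropy
  congr 1
  refine (Fintype.sum_of_injective f hf _ _ ?_ ?_).symm
  · intro b hb
    rw [map_apply_eq_sum, Finset.sum_eq_zero, Real.negMulLog_zero]
    intro ω _
    rw [if_neg]
    rintro rfl
    exact hb ⟨_, rfl⟩
  · intro a
    simp only [map_apply_eq_sum, hf.eq_iff]

lemma condEntropy_eq_zero (q : ℕ) (p : stdSimplex ℝ Ω) (X : Ω → α) (Y : Ω → β)
    (h : ∀ ω ω', Y ω = Y ω' → X ω = X ω') : condEntropy q p X Y = 0 := by
  obtain ⟨ω₀⟩ := nonempty_of_stdSimplex p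
  have : Nonempty α := ⟨X ω₀⟩
  obtain ⟨g, rfl⟩ := (Function.factorsThrough_iff X).1 (fun ω ω' => h ω ω')
  rw [condEntropy, sub_eq_zero]
  exact entropy_comp_injective q p Y (f := fun b => (g b, b)) fun b b' hb => congrArg Prod.snd hb

lemma sum_map_prodMk_left (p : stdSimplex ℝ Ω) (X : Ω → α) (Y : Ω → β) (a : α) :
    ∑ b, stdSimplex.map (fun ω => (X ω, Y ω)) p (a, b) = stdSimplex.map X p a := by
  classical
  simp only [map_apply_eq_sum]
  rw [Finset.sum_comm]
  refine Finset.sum_congr rfl fun ω _ => ?_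
  by_cases h : X ω = a <;> simp [h]

lemma sum_map_prodMk_right (p : stdSimplex ℝ Ω) (X : Ω → α) (Y : Ω → β) (b : β) :
    ∑ a, stdSimplex.map (fun ω => (X ω, Y ω)) p (a, b) = stdSimplex.map Y p b := by
  classical
  simp only [map_apply_eq_sum]
  rw [Finset.sum_comm]
  refine Finset.sum_congr rfl fun ω _ => ?_
  by_cases h : Y ω = b <;> simp [h]

/-- Random variables whose joint law factors as a product of probability vectors have zero mutual
information. -/
lemma mutualInfo_eq_zero (q : ℕ) (p : stdSimplex ℝ Ω) (X : Ω → α) (Y : Ω → β)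
    (u : α → ℝ) (v : β → ℝ) (hu : ∑ a, u a = 1)
    (h : ∀ a b, stdSimplex.map (fun ω => (X ω, Y ω)) p (a, b) = u a * v b) :
    mutualInfo q p X Y = 0 := by
  have hv : ∑ b, v b = 1 := by
    have := (stdSimplex.map (fun ω => (X ω, Y ω)) p).2.2
    change ∑ x, stdSimplex.map (fun ω => (X ω, Y ω)) p x = 1 at this
    rw [Fintype.sum_prod_type] at this
    simpa [h, ← Finset.mul_sum, ← Finset.sum_mul, hu] using this
  have hX : ∀ a, stdSimplex.map X p a = u a := fun a => by
    rw [← sum_map_prodMk_left p X Y a]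
    simp [h, ← Finset.mul_sum, hv]
  have hY : ∀ b, stdSimplex.map Y p b = v b := fun b => by
    rw [← sum_map_prodMk_right p X Y b]
    simp [h, ← Finset.sum_mul, hu]
  have hXY : ∑ x, Real.negMulLog (stdSimplex.map (fun ω => (X ω, Y ω)) p x) =
      ∑ a, Real.negMulLog (u a) + ∑ b, Real.negMulLog (v b) := by
    rw [Fintype.sum_prod_type]
    simp only [h, Real.negMulLog_mul, Finset.sum_add_distrib, ← Finset.mul_sum, ← Finset.sum_mul,
      hu, hv, one_mul]
  simp only [mutualInfo, entropy, hXY, hX, hY]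
  ring

/-- The uniform law maximizes entropy. -/
lemma entropy_le_log_card {q : ℕ} (hq : 1 < q) (p : stdSimplex ℝ Ω) (X : Ω → α) :
    entropy q p X ≤ Real.log (Fintype.card α) / Real.log q := by
  obtain ⟨ω₀⟩ := nonempty_of_stdSimplex p
  have : Nonempty α := ⟨X ω₀⟩
  have hcard : (0 : ℝ) < Fintype.card α := by exact_mod_cast Fintype.card_pos
  have hlog : 0 < Real.log q := Real.log_pos (by exact_mod_cast hq)
  unfold entropy
  gcongr
  have hJ := Real.concaveOn_negMulLog.le_map_sum (t := Finset.univ)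
    (w := fun _ : α => (Fintype.card α : ℝ)⁻¹) (p := fun a => stdSimplex.map X p a)
    (fun _ _ => by positivity) (by simp) (fun a _ => (stdSimplex.map X p).2.1 a)
  have hsum : ∑ a, stdSimplex.map X p a = 1 := (stdSimplex.map X p).2.2
  simp only [smul_eq_mul, ← Finset.mul_sum, hsum, mul_one] at hJ
  rw [Real.negMulLog, Real.log_inv] at hJ
  have := mul_le_mul_of_nonneg_left hJ hcard.le
  field_simp at this
  linarith

/-- If the conditional law of `Y` given a family of independent variables `D` depends on the
`k`-th of them only, then `Y` carries no information on the remaining ones. -/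
lemma mutualInfo_prodDist_piDist_eq_zero {ι : Type*} [Fintype ι] [DecidableEq ι] {A : ι → Type*}
    [∀ i, Fintype (A i)] (q : ℕ) (δ : ∀ i, stdSimplex ℝ (A i)) (p : stdSimplex ℝ Ω) (k : ι)
    (Y : (∀ i, A i) × Ω → β)
    (hY : ∀ D D' : ∀ i, A i, D k = D' k →
      ∃ e : Ω ≃ Ω, ∀ x, p (e x) = p x ∧ Y (D', e x) = Y (D, x)) :
    mutualInfo q (prodDist (piDist δ) p)
      (fun ω => fun i : {i : ι // i ≠ k} => ω.1 i) Y = 0 := by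
  classical
  let G : (∀ i, A i) → β → ℝ := fun D b => ∑ x, if Y (D, x) = b then p x else 0
  have hG : ∀ D D' b, D k = D' k → G D b = G D' b := by
    intro D D' b hD
    obtain ⟨e, he⟩ := hY D D' hD
    simp only [G]
    rw [← e.sum_comp (fun x => if Y (D', x) = b then p x else 0)]
    simp [he]
  let s := Equiv.piSplitAt k A
  obtain ⟨D₀⟩ := nonempty_of_stdSimplex (piDist δ)
  refine mutualInfo_eq_zero q _ _ _ (fun a => ∏ i : {i : ι // i ≠ k}, δ i (a i))
    (fun b => ∑ d, δ k d * G (Function.update D₀ k d) b) ?_ ?_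
  · exact (piDist fun i : {i : ι // i ≠ k} => δ i).2.2
  · intro a b
    rw [map_apply_eq_sum, Fintype.sum_prod_type, ← s.symm.sum_comp, Fintype.sum_prod_type,
      Finset.mul_sum]
    refine Finset.sum_congr rfl fun d _ => ?_
    have hs : ∀ a', (fun i : {i : ι // i ≠ k} => s.symm (d, a') i) = a' := fun a' =>
      congrArg Prod.snd (s.apply_symm_apply (d, a'))
    have hk : ∀ a', s.symm (d, a') k = d := fun a' =>
      congrArg Prod.fst (s.apply_symm_apply (d, a'))
    have hp : ∀ a' x, prodDist (piDist δ) p (s.symm (d, a'), x) =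
        δ k d * (∏ i : {i : ι // i ≠ k}, δ i (a' i)) * p x := by
      intro a' x
      change (∏ i, δ i (s.symm (d, a') i)) * p x = _
      rw [← Finset.mul_prod_erase _ _ (Finset.mem_univ k), hk]
      congr 2
      rw [Finset.prod_subtype (p := fun i => i ≠ k) (Finset.univ.erase k) (by simp)]
      refine Finset.prod_congr rfl fun i _ => ?_
      rw [← congrFun (hs a') i]
    rw [Finset.sum_eq_single a]
    · have : G (s.symm (d, a)) b = G (Function.update D₀ k d) b := hG _ _ _ (by simp [hk])
      rw [← this]
      simp only [G, hs, hp, Prod.mk.injEq, true_and, Finset.mul_sum]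
      refine Finset.sum_congr rfl fun x _ => ?_
      split_ifs <;> ring
    · intro a' _ ha
      refine Finset.sum_eq_zero fun x _ => ?_
      rw [if_neg]
      intro h
      exact ha ((hs a').symm.trans (congrArg Prod.fst h))
    · simp

end Information

/-! ### The message form -/

section AlternatingForms

open Module Set.powersetCard

variable {R X V : Type*} [CommRing R] [AddCommGroup X] [Module R X] [Fintype V] {r : ℕ}

/-- The message form `∑ₙ eₙ ∧ Wₙ`, where `eₙ` is the indicator one-form of the basis vectors `v`
with `d v = n`. Its value at an increasing tuple is a signed sum of subfiles. -/
noncomputable def deliveryForm {ι : Type*} (d : V → ι) (W : ι → (V → R) [⋀^Fin r]→ₗ[R] X) :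
    (V → R) [⋀^Fin (r + 1)]→ₗ[R] X :=
  AlternatingMap.alternatizeUncurryFin ((Pi.basisFun R V).constr R fun v => W (d v))

variable {ι : Type*} (d : V → ι) (W : ι → (V → R) [⋀^Fin r]→ₗ[R] X)

lemma deliveryForm_add (W' : ι → (V → R) [⋀^Fin r]→ₗ[R] X) :
    deliveryForm d (W + W') = deliveryForm d W + deliveryForm d W' := by
  rw [deliveryForm, deliveryForm, deliveryForm, ← AlternatingMap.alternatizeUncurryFin_add,
    ← map_add]
  rfl

lemma deliveryForm_smul (a : R) :
    deliveryForm d (a • W) = a • deliveryForm d W := by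
  rw [deliveryForm, deliveryForm, ← AlternatingMap.alternatizeUncurryFin_smul, ← map_smul]
  rfl

variable [LinearOrder V]

/-- The alternating form in `r` arguments on `V → R` with prescribed values on the increasing
`r`-tuples of standard basis vectors, an increasing tuple being encoded by its set of entries. -/
noncomputable def formEquiv (R X V : Type*) [CommRing R] [Nontrivial R] [AddCommGroup X]
    [Module R X] [Fintype V] [LinearOrder V] (r : ℕ) :
    (Set.powersetCard V r → X) ≃ₗ[R] ((V → R) [⋀^Fin r]→ₗ[R] X) :=
  ((Pi.basisFun R V).exteriorPower r).constr R ≪≫ₗ exteriorPower.alternatingMapLinearEquiv.symm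

lemma formEquiv_apply_basis [Nontrivial R] (w : Set.powersetCard V r → X) (s : Set.powersetCard V r) :
    formEquiv R X V r w (fun i => Pi.basisFun R V (ofFinEmbEquiv.symm s i)) = w s := by
  have h := ((Pi.basisFun R V).exteriorPower r).constr_basis R w s
  rw [exteriorPower.basis_apply] at h
  simpa [formEquiv, exteriorPower.ιMulti_family, Function.comp_def] using h

/-- An alternating form that vanishes on the increasing tuples of basis vectors that meet `U`
vanishes on all tuples of basis vectors that meet `U`. -/
lemma alternating_eq_zero_of_meets (f : (V → R) [⋀^Fin r]→ₗ[R] X) (U : Finset V)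
    (hf : ∀ s : Set.powersetCard V r, (∃ u ∈ U, u ∈ s) →
      f (fun i => Pi.basisFun R V (ofFinEmbEquiv.symm s i)) = 0)
    (t : Fin r → V) (ht : ∃ i, t i ∈ U) : f (fun i => Pi.basisFun R V (t i)) = 0 := by
  by_cases hinj : Function.Injective t
  · let s : Set.powersetCard V r := ofFinEmb r V ⟨t, hinj⟩
    have hmem : ∀ v, v ∈ s ↔ v ∈ Set.range t := 
      mem_ofFinEmb_iff_mem_range r V ⟨t, hinj⟩
    have hσ : ∀ i, ∃ j, ofFinEmbEquiv.symm s j = t i := fun i =>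
      (mem_range_ofFinEmbEquiv_symm_iff_mem s (t i)).2 ((hmem _).2 ⟨i, rfl⟩)
    choose σ hσ using hσ
    have hσinj : Function.Injective σ := fun i j hij => hinj (by rw [← hσ i, ← hσ j, hij])
    have h := f.map_perm (fun i => Pi.basisFun R V (ofFinEmbEquiv.symm s i))
      (Equiv.ofBijective σ (Finite.injective_iff_bijective.1 hσinj))
    obtain ⟨i, hi⟩ := ht
    rw [hf s ⟨t i, hi, (hmem _).2 ⟨i, rfl⟩⟩, smul_zero] at h
    simpa [Function.comp_def, hσ] using h
  · refine f.map_eq_zero_of_not_injective _ fun h => hinj fun i j hij => h ?_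
    simp [hij]

/-- The message form is determined by its values on the tuples of basis vectors that meet a set
`U` of leaders, that is, a set on which `d` takes all its values: every `eₙ` vanishes at
`v - u` if `d v = d u`, so the message form vanishes if every entry is such a difference, and
expanding by multilinearity with `u ∈ U` leaves tuples that meet `U`, except for the first. -/
lemma deliveryForm_eq_zero (U : Finset V) (hU : ∀ v, ∃ u ∈ U, d u = d v)
    (h : ∀ s : Set.powersetCard V (r + 1), (∃ u ∈ U, u ∈ s) →
      deliveryForm d W (fun i => Pi.basisFun R V (ofFinEmbEquiv.symm s i)) = 0) :
    deliveryForm d W = 0 := by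
  classical
  have hmeet := alternating_eq_zero_of_meets (deliveryForm d W) U h
  choose ρ hρU hρ using hU
  refine (Pi.basisFun R V).ext_alternating fun t _ => ?_
  set g := deliveryForm d W with hg
  have hzero : g ((fun i => Pi.basisFun R V (t i)) +
      fun i => -(Pi.basisFun R V (ρ (t i)))) = 0 := by
    rw [hg, deliveryForm, AlternatingMap.alternatizeUncurryFin_apply]
    refine Finset.sum_eq_zero fun i _ => ?_
    rw [Pi.add_apply, map_add, map_neg, Basis.constr_basis, Basis.constr_basis, hρ]
    simp
  have hexp := g.toMultilinearMap.map_add_univ (fun i => Pi.basisFun R V (t i))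
    (fun i => -(Pi.basisFun R V (ρ (t i))))
  rw [AlternatingMap.coe_multilinearMap, hzero, Finset.sum_eq_single Finset.univ] at hexp
  · simpa using hexp.symm
  · intro s _ hs
    obtain ⟨i, hi⟩ : ∃ i, i ∉ s := by
      by_contra! hall
      exact hs (Finset.eq_univ_of_forall hall)
    have hsign : s.piecewise (fun i => Pi.basisFun R V (t i))
        (fun i => -(Pi.basisFun R V (ρ (t i)))) =
        fun i => (if i ∈ s then (1 : R) else -1) •
          Pi.basisFun R V (s.piecewise t (fun i => ρ (t i)) i) := by
      funext j
      by_cases hj : j ∈ s <;> simp [hj]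
    rw [hsign, ← AlternatingMap.coe_multilinearMap, MultilinearMap.map_smul_univ,
      AlternatingMap.coe_multilinearMap, hmeet _ ⟨i, by simp [hi, hρU]⟩, smul_zero]
  · simp

/-- A user who knows the file forms on the tuples that meet `O` recovers the files demanded by
the elements of `O` from the message form, stated for the difference of two libraries. -/
lemma eq_zero_of_deliveryForm_eq_zero (O : Finset V)
    (hcache : ∀ n, ∀ s : Set.powersetCard V r, (∃ v ∈ O, v ∈ s) →
      W n (fun i => Pi.basisFun R V (ofFinEmbEquiv.symm s i)) = 0)
    (hW : deliveryForm d W = 0) {v : V} (hv : v ∈ O) : W (d v) = 0 := by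
  refine (Pi.basisFun R V).ext_alternating fun t _ => ?_
  have h := congrArg (fun g : (V → R) [⋀^Fin (r + 1)]→ₗ[R] X =>
    g (fun i => Pi.basisFun R V ((Fin.cons v t : Fin (r + 1) → V) i))) hW
  simp only [deliveryForm, AlternatingMap.alternatizeUncurryFin_apply, Fin.sum_univ_succ,
    Basis.constr_basis, AlternatingMap.zero_apply] at h
  rw [Finset.sum_eq_zero, add_zero] at h
  · rw [Fin.removeNth_zero] at h
    simpa [Fin.tail_def] using h
  · intro i _
    have hr : 0 < r := i.pos
    have : W (d ((Fin.cons v t : Fin (r + 1) → V) i.succ)) (i.succ.removeNth fun j =>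
        Pi.basisFun R V ((Fin.cons v t : Fin (r + 1) → V) j)) = 0 := by
      refine alternating_eq_zero_of_meets _ O (hcache _)
        (fun j => (Fin.cons v t : Fin (r + 1) → V) (i.succ.succAbove j)) ⟨⟨0, hr⟩, ?_⟩
      obtain ⟨r, rfl⟩ : ∃ r', r = r' + 1 := ⟨r - 1, by omega⟩
      change (Fin.cons v t : Fin (r + 1 + 1) → V) (i.succ.succAbove 0) ∈ O
      simpa using hv
    rw [this, smul_zero]

end AlternatingForms

/-! ### Linear codes for virtual users -/

section LinearCodes

variable {q N F c b L : ℕ} {V : Type*}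

/-- A linear coded caching scheme without privacy, for virtual users `V`: a receiver that caches
on behalf of any `L` virtual users recovers the files that these demand from `b` broadcast
symbols, whenever all the demanded files are demanded within the set `U` of leaders. Decoding is
expressed by linearity: a library that is invisible to the receiver has vanishing demanded
files. -/
def HasLinearCode (q N F c b L : ℕ) {V : Type*} (U : Finset V) : Prop :=
  ∃ enc : (V → Fin N) → Library q N F →ₗ[ZMod q] (Fin b → ZMod q),
    ∀ O : Finset V, O.card = L → ∃ cache : Library q N F →ₗ[ZMod q] (Fin c → ZMod q),
      ∀ d : V → Fin N, (∀ v, ∃ u ∈ U, d u = d v) → ∀ w, cache w = 0 → enc d w = 0 →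
        ∀ v ∈ O, w (d v) = 0

/-- The code for files without symbols. -/
lemma hasLinearCode_zero (q N L : ℕ) (U : Finset V) : HasLinearCode q N 0 0 0 L U :=
  ⟨fun _ => 0, fun _ _ => ⟨0, fun _ _ _ _ _ _ _ => Subsingleton.elim _ _⟩⟩

/-- Memory sharing: files are split in two parts, to which two codes are applied. -/
lemma HasLinearCode.add {F' c' b' : ℕ} {U : Finset V} (h : HasLinearCode q N F c b L U)
    (h' : HasLinearCode q N F' c' b' L U) :
    HasLinearCode q N (F + F') (c + c') (b + b') L U := by
  obtain ⟨enc, h⟩ := h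
  obtain ⟨enc', h'⟩ := h'
  let left : Library q N (F + F') →ₗ[ZMod q] Library q N F :=
    LinearMap.pi fun n => LinearMap.funLeft _ _ (Fin.castAdd F') ∘ₗ LinearMap.proj n
  let right : Library q N (F + F') →ₗ[ZMod q] Library q N F' :=
    LinearMap.pi fun n => LinearMap.funLeft _ _ (Fin.natAdd F) ∘ₗ LinearMap.proj n
  let join : ∀ {x y : ℕ} {A : Type} [AddCommGroup A] [Module (ZMod q) A]
      (f : A →ₗ[ZMod q] (Fin x → ZMod q)) (g : A →ₗ[ZMod q] (Fin y → ZMod q)),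
      A →ₗ[ZMod q] (Fin (x + y) → ZMod q) := fun f g =>
    LinearMap.pi fun i => Fin.addCases (fun i => LinearMap.proj i ∘ₗ f)
      (fun i => LinearMap.proj i ∘ₗ g) i
  have hjoin : ∀ {x y : ℕ} {A : Type} [AddCommGroup A] [Module (ZMod q) A]
      (f : A →ₗ[ZMod q] (Fin x → ZMod q)) (g : A →ₗ[ZMod q] (Fin y → ZMod q)) (a : A),
      join f g a = 0 → f a = 0 ∧ g a = 0 := by
    intro x y A _ _ f g a ha
    constructor
    · funext i
      simpa [join] using congrFun ha (Fin.castAdd y i)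
    · funext i
      simpa [join] using congrFun ha (Fin.natAdd x i)
  refine ⟨fun d => join (enc d ∘ₗ left) (enc' d ∘ₗ right), fun O hO => ?_⟩
  obtain ⟨cache, h⟩ := h O hO
  obtain ⟨cache', h'⟩ := h' O hO
  refine ⟨join (cache ∘ₗ left) (cache' ∘ₗ right), fun d hd w hc he v hv => ?_⟩
  obtain ⟨hc, hc'⟩ := hjoin _ _ _ hc
  obtain ⟨he, he'⟩ := hjoin _ _ _ he
  have h1 := h d hd (left w) hc he v hv
  have h2 := h' d hd (right w) hc' he' v hv
  funext i
  induction i using Fin.addCases with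
  | left i => exact congrFun h1 i
  | right i => exact congrFun h2 i

lemma HasLinearCode.sum {ι : Type*} (s : Finset ι) {F c b : ι → ℕ} {U : Finset V}
    (h : ∀ i ∈ s, HasLinearCode q N (F i) (c i) (b i) L U) :
    HasLinearCode q N (∑ i ∈ s, F i) (∑ i ∈ s, c i) (∑ i ∈ s, b i) L U := by
  classical
  induction s using Finset.induction_on with
  | empty => exact hasLinearCode_zero q N L U
  | insert i s hi ih =>
    simp only [Finset.sum_insert hi]
    exact (h i (by simp)).add (ih fun j hj => h j (by simp [hj]))

open Classical in
lemma card_powersetCard_meets [Fintype V] (r : ℕ) (U : Finset V) :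
    Fintype.card {s : Set.powersetCard V r // ∃ u ∈ U, u ∈ s} =
      (Fintype.card V).choose r - (Fintype.card V - U.card).choose r := by
  have htot : Fintype.card (Set.powersetCard V r) = (Fintype.card V).choose r := by
    rw [← Nat.card_eq_fintype_card, Set.powersetCard.card, Nat.card_eq_fintype_card]
  have hcompl : Fintype.card {s : Set.powersetCard V r // ¬ ∃ u ∈ U, u ∈ s} =
      (Fintype.card V - U.card).choose r := by
    rw [← Finset.card_compl, ← Finset.card_powersetCard, ← Fintype.card_coe]
    refine Fintype.card_congr
      ⟨fun s => ⟨s.1.1, ?_⟩, fun s => ⟨⟨s.1, (Finset.mem_powersetCard.1 s.2).2⟩, ?_⟩,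
        fun _ => rfl, fun _ => rfl⟩
    · refine Finset.mem_powersetCard.2 ⟨fun v hv => ?_, s.1.2⟩
      exact Finset.mem_compl.2 fun hvU => s.2 ⟨v, hvU, hv⟩
    · rintro ⟨u, hu, hus⟩
      exact Finset.mem_compl.1 ((Finset.mem_powersetCard.1 s.2).1 hus) hu
  rw [← hcompl, Fintype.card_subtype_compl, htot]
  have := Fintype.card_subtype_le fun s : Set.powersetCard V r => ∃ u ∈ U, u ∈ s
  omega

/-- The code at which every receiver stores the subfiles whose labels, `r`-subsets of `V`, meet
its set of virtual users, and the values of the message form at the `(r+1)`-subsets that meet the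
leaders are broadcast. Each subfile has `m` symbols. -/
theorem hasLinearCode_choose (q N L : ℕ) [Nontrivial (ZMod q)] [Fintype V] [LinearOrder V]
    (U : Finset V) (r m : ℕ) :
    HasLinearCode q N ((Fintype.card V).choose r * m)
      (N * ((Fintype.card V).choose r - (Fintype.card V - L).choose r) * m)
      (((Fintype.card V).choose (r + 1) - (Fintype.card V - U.card).choose (r + 1)) * m) L U := by
  classical
  let e : Set.powersetCard V r × Fin m ≃ Fin ((Fintype.card V).choose r * m) :=
    Fintype.equivFinOfCardEq (by
      rw [Fintype.card_prod, Fintype.card_fin, ← Nat.card_eq_fintype_card,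
        Set.powersetCard.card, Nat.card_eq_fintype_card])
  let e' : {s : Set.powersetCard V (r + 1) // ∃ u ∈ U, u ∈ s} × Fin m ≃ Fin
      (((Fintype.card V).choose (r + 1) - (Fintype.card V - U.card).choose (r + 1)) * m) :=
    Fintype.equivFinOfCardEq (by
      rw [Fintype.card_prod, Fintype.card_fin, card_powersetCard_meets])
  let form (w : Library q N ((Fintype.card V).choose r * m)) (n : Fin N) :
      (V → ZMod q) [⋀^Fin r]→ₗ[ZMod q] (Fin m → ZMod q) :=
    formEquiv (ZMod q) (Fin m → ZMod q) V r fun s a => w n (e (s, a))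
  have hadd : ∀ w w', form (w + w') = form w + form w' := fun w w' => by
    funext n
    exact map_add (formEquiv (ZMod q) (Fin m → ZMod q) V r) (fun s a => w n (e (s, a)))
      (fun s a => w' n (e (s, a)))
  have hsmul : ∀ (x : ZMod q) w, form (x • w) = x • form w := fun x w => by
    funext n
    exact map_smul (formEquiv (ZMod q) (Fin m → ZMod q) V r) x (fun s a => w n (e (s, a)))
  let enc (d : V → Fin N) : Library q N ((Fintype.card V).choose r * m) →ₗ[ZMod q] (Fin
      (((Fintype.card V).choose (r + 1) - (Fintype.card V - U.card).choose (r + 1)) * m) →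
        ZMod q) :=
    { toFun := fun w i => deliveryForm d (form w) (fun j => Pi.basisFun (ZMod q) V
        (Set.powersetCard.ofFinEmbEquiv.symm (e'.symm i).1.1 j)) (e'.symm i).2
      map_add' := fun w w' => by
        funext i
        rw [hadd, deliveryForm_add]
        rfl
      map_smul' := fun x w => by
        funext i
        rw [hsmul, deliveryForm_smul]
        rfl }
  refine ⟨enc, fun O hO => ?_⟩
  subst hO
  let e'' : (Fin N × {s : Set.powersetCard V r // ∃ v ∈ O, v ∈ s}) × Fin m ≃ Fin
      (N * ((Fintype.card V).choose r - (Fintype.card V - O.card).choose r) * m) :=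
    Fintype.equivFinOfCardEq (by
      rw [Fintype.card_prod, Fintype.card_prod, Fintype.card_fin, Fintype.card_fin,
        card_powersetCard_meets])
  refine ⟨LinearMap.pi fun i => LinearMap.proj (e ((e''.symm i).1.2.1, (e''.symm i).2)) ∘ₗ
    LinearMap.proj (e''.symm i).1.1, fun d hd w hc he v hv => ?_⟩
  have hform : form w (d v) = 0 := by
    refine eq_zero_of_deliveryForm_eq_zero d (form w) O (fun n s hs => ?_)
      (deliveryForm_eq_zero d (form w) U hd fun s hs => ?_) hv
    · rw [formEquiv_apply_basis]
      funext a
      simpa using congrFun hc (e'' ((n, ⟨s, hs⟩), a))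
    · funext a
      simpa [enc] using congrFun he (e' (⟨s, hs⟩, a))
  have hw : (fun s a => w (d v) (e (s, a))) = 0 :=
    (LinearEquiv.map_eq_zero_iff (formEquiv (ZMod q) (Fin m → ZMod q) V r)).1 hform
  funext i
  simpa using congrFun (congrFun hw (e.symm i).1) (e.symm i).2

end LinearCodes

/-! ### Private schemes from linear codes -/

section PrivateScheme

open Equiv

variable {q N K L F c b n : ℕ}

/-- The permutations of the files that preserve the set of the first `n` files. -/
def slotGroup (N n : ℕ) : Subgroup (Perm (Fin N)) where
  carrier := {σ | ∀ j, (σ j : ℕ) < n ↔ (j : ℕ) < n}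
  mul_mem' := fun hσ hτ j => (hσ _).trans (hτ j)
  one_mem' := fun _ => Iff.rfl
  inv_mem' := fun {σ} hσ j => by simpa using (hσ (σ⁻¹ j)).symm

lemma mem_slotGroup {σ : Perm (Fin N)} :
    σ ∈ slotGroup N n ↔ ∀ j, (σ j : ℕ) < n ↔ (j : ℕ) < n := Iff.rfl

/-- All demand vectors extend to permutations of the files under which the first `n` files have
a common image, a set of `n` files that contains the demanded ones. -/
lemma exists_perm_extending_demands (hn : n ≤ N) (hmin : min N (K * L) ≤ n) (hLn : L ≤ n)
    (D : DemandMatrix N K L) :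
    ∃ E : Fin K → Perm (Fin N), (∀ k (l : Fin L), E k (Fin.castLE (hLn.trans hn) l) = D k l) ∧
      ∀ i k, (E i)⁻¹ * E k ∈ slotGroup N n := by
  classical
  let B : Finset (Fin N) := Finset.univ.biUnion fun k => Finset.univ.map (D k)
  have hB : B.card ≤ n := by
    refine le_trans (le_min ?_ ?_) hmin
    · simpa using B.card_le_univ
    · simpa using Finset.card_biUnion_le_card_mul Finset.univ (fun k => Finset.univ.map (D k)) L
        (by simp)
  obtain ⟨A, hBA, hA⟩ := Finset.exists_superset_card_eq hB (by simpa using hn)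
  have key : ∀ k, ∃ e : Perm (Fin N), (∀ l : Fin L, e (Fin.castLE (hLn.trans hn) l) = D k l) ∧
      ∀ j : Fin N, (j : ℕ) < n → e j ∈ A := by
    intro k
    have hmem : ∀ l, D k l ∈ A := fun l => hBA (by
      simp only [B, Finset.mem_biUnion, Finset.mem_map, Finset.mem_univ, true_and]
      exact ⟨k, l, rfl⟩)
    let f : Fin n → Fin N := fun j => if h : (j : ℕ) < L then D k ⟨j, h⟩ else Fin.castLE hn j
    obtain ⟨g, hg⟩ := Finset.exists_equiv_extend_of_card_eq (t := A) (by simpa using hA.symm)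
      (s := Finset.univ.filter fun j : Fin n => (j : ℕ) < L) (f := f)
      (by
        intro x hx
        obtain ⟨j, hj, rfl⟩ := Finset.mem_image.1 hx
        have hj' : (j : ℕ) < L := by simpa using hj
        simp only [f, dif_pos hj']
        exact hmem _)
      (by
        intro i hi j hj hij
        have hi' : (i : ℕ) < L := by simpa using hi
        have hj' : (j : ℕ) < L := by simpa using hj
        simp only [f, dif_pos hi', dif_pos hj'] at hij
        simpa [Fin.ext_iff] using (D k).injective hij)
    let f' : Fin N → Fin N := fun j => if h : (j : ℕ) < n then g ⟨j, h⟩ else j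
    obtain ⟨e, he⟩ := Finset.exists_equiv_extend_of_card_eq
      (t := (Finset.univ : Finset (Fin N))) (by simp)
      (s := Finset.univ.filter fun j : Fin N => (j : ℕ) < n) (f := f') (by simp)
      (by
        intro i hi j hj hij
        have hi' : (i : ℕ) < n := by simpa using hi
        have hj' : (j : ℕ) < n := by simpa using hj
        simp only [f', dif_pos hi', dif_pos hj'] at hij
        simpa [Fin.ext_iff] using g.injective (Subtype.ext hij))
    have he' : ∀ j : Fin N, ∀ h : (j : ℕ) < n, (e j : Fin N) = g ⟨j, h⟩ := fun j h => by
      rw [he j (by simpa using h)]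
      simp [f', h]
    refine ⟨e.trans (Equiv.subtypeUnivEquiv fun _ => Finset.mem_univ _), fun l => ?_,
      fun j hj => ?_⟩
    · have hl : ((Fin.castLE (hLn.trans hn) l : Fin N) : ℕ) < n := l.2.trans_le hLn
      refine (he' _ hl).trans ?_
      rw [hg _ (by simp)]
      simp [f]
    · have hgA := (g ⟨j, hj⟩).2
      rwa [← he' j hj] at hgA
  choose E hE hEA using key
  have hEA' : ∀ k j, E k j ∈ A ↔ (j : ℕ) < n := by
    intro k
    have hsub : (Finset.univ.filter fun j : Fin N => (j : ℕ) < n).map (E k).toEmbedding = A := by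
      refine Finset.eq_of_subset_of_card_le ?_ ?_
      · intro x hx
        obtain ⟨j, hj, rfl⟩ := Finset.mem_map.1 hx
        exact hEA k j (by simpa using hj)
      · rw [hA, Finset.card_map, Fin.card_filter_val_lt, min_eq_right hn]
    intro j
    rw [← hsub]
    simp
  refine ⟨E, hE, fun i k j => ?_⟩
  rw [← hEA' i, ← hEA' k]
  simp

/-- The virtual users of user `k` for which it caches: those to which its secret permutation `σ`
takes the positions of the demand vector. -/
def ownVirtualUsers (hLn : L ≤ n) (hn : n ≤ N) (k : Fin K) (σ : slotGroup N n) :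
    Finset (Fin K × Fin n) :=
  Finset.univ.map ⟨fun l : Fin L =>
    (k, ⟨σ.1 (Fin.castLE (hLn.trans hn) l), (σ.2 _).2 (l.2.trans_le hLn)⟩), fun l l' h => by
      simpa [← Fin.ext_iff] using h⟩

/-- The labels of the files demanded by the virtual users, when those of user `k` are read off
from a permutation `y k`. -/
def virtualDemand (hn : n ≤ N) (y : Fin K → Perm (Fin N)) (v : Fin K × Fin n) : Fin N :=
  y v.1 (Fin.castLE hn v.2)

/-- A linear code for `n` virtual users per user yields a private scheme whose side information
has bounded size. -/
theorem exists_private_scheme [Fact q.Prime] (hK : 0 < K) (hn : n ≤ N)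
    (hmin : min N (K * L) ≤ n) (hLn : L ≤ n)
    (hcode : HasLinearCode q N F c b L
      (Finset.univ.map (Function.Embedding.sectR (⟨0, hK⟩ : Fin K) (Fin n)))) :
    ∃ 𝒮 : Scheme q N K L F c b, 𝒮.Correct ∧ 𝒮.Private ∧
      (∀ k, Fintype.card (𝒮.S k) ≤ N.factorial ^ K) ∧
      Fintype.card 𝒮.J ≤ N.factorial ^ K := by
  classical
  obtain ⟨enc, hcode⟩ := hcode
  have hO : ∀ (k : Fin K) (σ : slotGroup N n), (ownVirtualUsers hLn hn k σ).card = L := by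
    intro k σ
    simp [ownVirtualUsers]
  choose cache hdec using fun k σ => hcode _ (hO k σ)
  choose E hE hEslot using exists_perm_extending_demands hn hmin hLn (K := K)
  -- The `n` active files get labels by the server's secret `π`; the virtual users of user `k`
  -- demand the labels of the active files in an order scrambled by the secret `σ k`.
  let y (D : DemandMatrix N K L) (π : Perm (Fin N)) (σ : Fin K → slotGroup N n) :
      Fin K → Perm (Fin N) := fun k => π⁻¹ * E D k * (σ k : Perm (Fin N))⁻¹
  let 𝒮 : Scheme q N K L F c b :=
    { S := fun _ => slotGroup N n
      P := Perm (Fin N)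
      J := Fin K → Perm (Fin N)
      lawS := fun _ => uniformDist _
      lawP := uniformDist _
      φ := fun k σ π W => cache k σ fun j => W (π j)
      ψ := fun D π σ W => enc (virtualDemand hn (y D π σ)) fun j => W (π j)
      μ := fun D π σ => y D π σ }
  have hcover : ∀ D π σ, ∀ v : Fin K × Fin n,
      ∃ u ∈ Finset.univ.map (Function.Embedding.sectR (⟨0, hK⟩ : Fin K) (Fin n)),
        virtualDemand hn (y D π σ) u = virtualDemand hn (y D π σ) v := by
    intro D π σ v
    let i₀ : Fin K := ⟨0, hK⟩
    have hmem : (σ i₀ : Perm (Fin N)) * ((E D i₀)⁻¹ * E D v.1) * (σ v.1 : Perm (Fin N))⁻¹ ∈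
        slotGroup N n :=
      mul_mem (mul_mem (σ i₀).2 (hEslot D i₀ v.1)) (inv_mem (σ v.1).2)
    refine ⟨(i₀, ⟨_, (hmem (Fin.castLE hn v.2)).2 v.2.2⟩), by simp [i₀], ?_⟩
    simp [virtualDemand, y, Fin.castLE]
  refine ⟨𝒮, fun δ k => ?_, fun δ k => ?_, fun k => ?_, ?_⟩
  · refine condEntropy_eq_zero _ _ _ _ ?_
    rintro ⟨D, π, σ, W⟩ ⟨D', π', σ', W'⟩ h
    simp only [Scheme.broadcast, Scheme.cache, Prod.mk.injEq, 𝒮] at h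
    obtain ⟨⟨henc, hy⟩, hD, hcache, hσ⟩ := h
    rw [← hy] at henc
    rw [← hσ] at hcache
    funext l
    have hz := hdec k (σ k) (virtualDemand hn (y D π σ)) (hcover D π σ)
      ((fun j => W (π j)) - fun j => W' (π' j))
      (by rw [map_sub, hcache, sub_self]) (by rw [map_sub, henc, sub_self])
      (k, ⟨(σ k).1 (Fin.castLE (hLn.trans hn) l), ((σ k).2 _).2 (l.2.trans_le hLn)⟩)
      (Finset.mem_map.2 ⟨l, Finset.mem_univ _, rfl⟩)
    have hlabel : ∀ D π σ, y D π σ k ((σ k).1 (Fin.castLE (hLn.trans hn) l)) =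
        π⁻¹ (D k l) := by
      intro D π σ
      simp [y, hE]
    have h1 : virtualDemand hn (y D π σ)
        (k, ⟨(σ k).1 (Fin.castLE (hLn.trans hn) l), ((σ k).2 _).2 (l.2.trans_le hLn)⟩) =
        y D π σ k ((σ k).1 (Fin.castLE (hLn.trans hn) l)) := rfl
    rw [h1, Pi.sub_apply, sub_eq_zero] at hz
    rw [hlabel] at hz
    have h2 : π⁻¹ (D k l) = π'⁻¹ (D' k l) := by
      rw [← hlabel D π σ, ← hlabel D' π' σ', hy, hσ]
    have h3 : π' (π⁻¹ (D k l)) = D' k l := by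
      rw [h2]
      exact Equiv.apply_symm_apply (π' : Perm (Fin N)) _
    have h4 : π (π⁻¹ (D k l)) = D k l := Equiv.apply_symm_apply (π : Perm (Fin N)) _
    rwa [h3, h4] at hz
  · refine mutualInfo_prodDist_piDist_eq_zero q δ 𝒮.law k _ fun D D' hD => ?_
    -- The change of secrets that makes `D'` look like `D`; it fixes the secret of user `k`.
    let τ : Perm (Fin N) := E D' k * (E D k)⁻¹
    let g : Fin K → slotGroup N n := fun i =>
      ⟨(E D i)⁻¹ * E D k, hEslot D i k⟩ * ⟨(E D' k)⁻¹ * E D' i, hEslot D' k i⟩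
    have hgk : g k = 1 := by
      apply Subtype.ext
      simp [g]
    have hy : ∀ π (σ : Fin K → slotGroup N n),
        y D' (τ * π) (fun i => σ i * g i) = y D π σ := by
      intro π σ
      funext i
      simp only [y, τ, g, Subgroup.coe_mul]
      group
    have hW : ∀ (π : Perm (Fin N)) (W : Library q N F),
        (fun j => W (τ.symm ((τ * π) j))) = fun j => W (π j) := by
      intro π W
      simp
    refine ⟨Equiv.prodCongr (Equiv.mulLeft τ) (Equiv.prodCongr
      (Equiv.piCongrRight fun i => Equiv.mulRight (g i))
      (Equiv.arrowCongr τ (Equiv.refl _))), ?_⟩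
    rintro ⟨π, σ, W⟩
    refine ⟨rfl, ?_⟩
    refine Prod.ext (Prod.ext ?_ ?_) (Prod.ext (Prod.ext ?_ ?_) ?_)
    · change enc (virtualDemand hn (y D' (τ * π) fun i => σ i * g i))
        (fun j => W (τ.symm ((τ * π) j))) = enc (virtualDemand hn (y D π σ)) fun j => W (π j)
      rw [hy, hW]
    · exact hy π σ
    · change cache k (σ k * g k) (fun j => W (τ.symm ((τ * π) j))) =
        cache k (σ k) fun j => W (π j)
      rw [hgk, mul_one, hW]
    · change σ k * g k = σ k
      rw [hgk, mul_one]
    · exact hD.symm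
  · calc Fintype.card (slotGroup N n) ≤ Fintype.card (Perm (Fin N)) :=
          Fintype.card_subtype_le _
      _ = N.factorial := by rw [Fintype.card_perm, Fintype.card_fin]
      _ ≤ N.factorial ^ K := Nat.le_self_pow hK.ne' _
  · change Fintype.card (Fin K → Perm (Fin N)) ≤ _
    rw [Fintype.card_fun, Fintype.card_perm, Fintype.card_fin, Fintype.card_fin]

end PrivateScheme

/-! ### Memory sharing -/

section MemorySharing

variable {q N K L : ℕ}

lemma Nbar_pos (hN : 0 < N) (hK : 0 < K) (hL : 0 < L) : 0 < Nbar N K L :=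
  lt_min hN (Nat.mul_pos hK hL)

lemma le_Nbar (hK : 0 < K) (hLN : L ≤ N) : L ≤ Nbar N K L :=
  le_min hLN (Nat.le_mul_of_pos_left L hK)

/-- The code for files of `C(KN̄, r) * m` symbols attains the memory-rate pair with parameter
`r` exactly. -/
lemma exists_code_memoryRatePoint [Fact q.Prime] (hK : 0 < K) (r m : ℕ)
    (hr : r ≤ K * Nbar N K L) :
    ∃ c b : ℕ, HasLinearCode q N ((K * Nbar N K L).choose r * m) c b L
        (Finset.univ.map (Function.Embedding.sectR (⟨0, hK⟩ : Fin K) (Fin (Nbar N K L)))) ∧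
      (c : ℝ) = (memoryRatePoint N K L r).1 * (((K * Nbar N K L).choose r * m : ℕ) : ℝ) ∧
      (b : ℝ) = (memoryRatePoint N K L r).2 * (((K * Nbar N K L).choose r * m : ℕ) : ℝ) := by
  have : Nontrivial (ZMod q) := inferInstance
  let inst : LinearOrder (Fin K × Fin (Nbar N K L)) :=
    LinearOrder.lift' finProdFinEquiv finProdFinEquiv.injective
  have h := @hasLinearCode_choose (Fin K × Fin (Nbar N K L)) q N L _ _ inst
    (Finset.univ.map (Function.Embedding.sectR (⟨0, hK⟩ : Fin K) (Fin (Nbar N K L)))) r m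
  simp only [Fintype.card_prod, Fintype.card_fin, Finset.card_map, Finset.card_univ] at h
  have hpos : (((K * Nbar N K L).choose r : ℕ) : ℝ) ≠ 0 := by
    exact_mod_cast (Nat.choose_pos hr).ne'
  refine ⟨_, _, h, ?_, ?_⟩
  · rw [Nat.cast_mul, Nat.cast_mul, Nat.cast_sub (Nat.choose_le_choose _ (Nat.sub_le _ _)),
      memoryRatePoint]
    push_cast
    field_simp
  · rw [Nat.cast_mul, Nat.cast_sub (Nat.choose_le_choose _ (Nat.sub_le _ _)),
      memoryRatePoint, Nat.sub_mul, one_mul]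
    push_cast
    field_simp

lemma memoryRatePoint_nonneg (r : ℕ) :
    0 ≤ (memoryRatePoint N K L r).1 ∧ 0 ≤ (memoryRatePoint N K L r).2 := by
  have h1 : (((K * Nbar N K L - L).choose r : ℕ) : ℝ) ≤ (K * Nbar N K L).choose r := by
    exact_mod_cast Nat.choose_le_choose _ (Nat.sub_le _ _)
  have h2 : ((((K - 1) * Nbar N K L).choose (r + 1) : ℕ) : ℝ) ≤
      (K * Nbar N K L).choose (r + 1) := by
    exact_mod_cast Nat.choose_le_choose _ (Nat.mul_le_mul_right _ (Nat.sub_le _ _))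
  unfold memoryRatePoint
  constructor
  · have := sub_nonneg.2 h1
    positivity
  · have := sub_nonneg.2 h2
    positivity

lemma memoryRatePoint_zero : (memoryRatePoint N K L 0).1 = 0 := by
  simp [memoryRatePoint]

lemma memoryRatePoint_last (hN : 0 < N) (hK : 0 < K) (hL : 0 < L) :
    (memoryRatePoint N K L (K * Nbar N K L)).1 = N := by
  have hpos : 0 < K * Nbar N K L := Nat.mul_pos hK (Nbar_pos hN hK hL)
  simp [memoryRatePoint, Nat.choose_eq_zero_of_lt (show K * Nbar N K L - L < K * Nbar N K L by
    omega)]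

/-- Memory sharing attains each point of the convex hull, up to a bounded number of broadcast
symbols for the symbols of the files that are left over after rounding. -/
lemma exists_code_of_mem_convexHull [Fact q.Prime] (hK : 0 < K) {x : ℝ × ℝ}
    (hx : x ∈ convexHull ℝ {x : ℝ × ℝ | ∃ r ∈ Finset.Icc 0 (K * Nbar N K L),
      x = memoryRatePoint N K L r}) :
    ∃ B : ℝ, 0 ≤ B ∧ ∀ F : ℕ, ∃ c b : ℕ, (c : ℝ) ≤ x.1 * F ∧ (b : ℝ) ≤ x.2 * F + B ∧
      HasLinearCode q N F c b L
        (Finset.univ.map (Function.Embedding.sectR (⟨0, hK⟩ : Fin K) (Fin (Nbar N K L)))) := by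
  rw [mem_convexHull_iff_exists_fintype] at hx
  obtain ⟨ι, _, w, z, hw, hw1, hz, rfl⟩ := hx
  choose r hr hzr using hz
  have hr' : ∀ i, r i ≤ K * Nbar N K L := fun i => (Finset.mem_Icc.1 (hr i)).2
  obtain rfl : z = fun i => memoryRatePoint N K L (r i) := funext hzr
  set C : ι → ℕ := fun i => (K * Nbar N K L).choose (r i)
  have hC : ∀ i, (0 : ℝ) < C i := fun i => by exact_mod_cast Nat.choose_pos (hr' i)
  refine ⟨(memoryRatePoint N K L 0).2 * ∑ i, (C i : ℝ),
    mul_nonneg (memoryRatePoint_nonneg 0).2 (Finset.sum_nonneg fun i _ => (hC i).le),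
    fun F => ?_⟩
  let m : ι → ℕ := fun i => ⌊w i * F / C i⌋₊
  have hm_le : ∀ i, ((C i * m i : ℕ) : ℝ) ≤ w i * F := fun i => by
    have := Nat.floor_le (show 0 ≤ w i * F / C i from
      div_nonneg (mul_nonneg (hw i) (Nat.cast_nonneg F)) (hC i).le)
    rw [le_div_iff₀ (hC i)] at this
    push_cast
    linarith
  have hm_ge : ∀ i, w i * F ≤ ((C i * m i : ℕ) : ℝ) + C i := fun i => by
    have := (Nat.lt_floor_add_one (w i * F / C i)).le
    rw [div_le_iff₀ (hC i)] at this
    push_cast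
    linarith
  have hsum : ∑ i, w i * F = F := by rw [← Finset.sum_mul, hw1, one_mul]
  have hle : ∑ i, C i * m i ≤ F := by
    have : ((∑ i, C i * m i : ℕ) : ℝ) ≤ F := by
      rw [Nat.cast_sum, ← hsum]
      exact Finset.sum_le_sum fun i _ => hm_le i
    exact_mod_cast this
  have hrest : ((F - ∑ i, C i * m i : ℕ) : ℝ) ≤ ∑ i, (C i : ℝ) := by
    rw [Nat.cast_sub hle, Nat.cast_sum]
    have := Finset.sum_le_sum fun i (_ : i ∈ Finset.univ) => hm_ge i
    rw [hsum, Finset.sum_add_distrib] at this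
    linarith
  choose c b hcode hc hb using fun i =>
    exists_code_memoryRatePoint (q := q) (N := N) (L := L) hK (r i) (m i) (hr' i)
  -- The remaining symbols are sent uncached, by the code with parameter `0`.
  obtain ⟨c', b', hcode', hc', hb'⟩ := exists_code_memoryRatePoint (q := q) (N := N) (L := L) hK
    0 (F - ∑ i, C i * m i) (Nat.zero_le _)
  have hF : ∑ i, C i * m i + (K * Nbar N K L).choose 0 * (F - ∑ i, C i * m i) = F := by
    rw [Nat.choose_zero_right, one_mul]
    omega
  refine ⟨∑ i, c i + c', ∑ i, b i + b', ?_, ?_, ?_⟩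
  · rw [memoryRatePoint_zero, zero_mul] at hc'
    rw [Nat.cast_add, hc', add_zero, Nat.cast_sum, Prod.fst_sum, Finset.sum_mul]
    refine Finset.sum_le_sum fun i _ => ?_
    rw [hc, Prod.smul_fst, smul_eq_mul]
    nlinarith [mul_le_mul_of_nonneg_left (hm_le i)
      (memoryRatePoint_nonneg (N := N) (K := K) (L := L) (r i)).1]
  · rw [Nat.cast_add, Nat.cast_sum, Prod.snd_sum, Finset.sum_mul]
    refine add_le_add (Finset.sum_le_sum fun i _ => ?_) ?_
    · rw [hb, Prod.smul_snd, smul_eq_mul]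
      nlinarith [mul_le_mul_of_nonneg_left (hm_le i)
        (memoryRatePoint_nonneg (N := N) (K := K) (L := L) (r i)).2]
    · rw [hb', Nat.choose_zero_right, one_mul]
      exact mul_le_mul_of_nonneg_left hrest (memoryRatePoint_nonneg 0).2
  · have := (HasLinearCode.sum Finset.univ fun i _ => hcode i).add hcode'
    rwa [hF] at this

lemma exists_mem_convexHull (hN : 0 < N) (hK : 0 < K) (hL : 0 < L) {M : ℝ}
    (hM : M ∈ Set.Icc (0 : ℝ) N) :
    ∃ R, (M, R) ∈ convexHull ℝ {x : ℝ × ℝ | ∃ r ∈ Finset.Icc 0 (K * Nbar N K L),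
      x = memoryRatePoint N K L r} := by
  have hN' : (0 : ℝ) < N := by exact_mod_cast hN
  have h0 := subset_convexHull ℝ {x : ℝ × ℝ | ∃ r ∈ Finset.Icc 0 (K * Nbar N K L),
    x = memoryRatePoint N K L r} ⟨0, by simp, rfl⟩
  have h1 := subset_convexHull ℝ {x : ℝ × ℝ | ∃ r ∈ Finset.Icc 0 (K * Nbar N K L),
    x = memoryRatePoint N K L r} ⟨K * Nbar N K L, by simp, rfl⟩
  have h := (convex_convexHull ℝ _) h0 h1 (a := 1 - M / N) (b := M / N)
    (by rw [sub_nonneg, div_le_one hN']; exact hM.2) (div_nonneg hM.1 hN'.le) (by ring)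
  refine ⟨((1 - M / N) • memoryRatePoint N K L 0 +
    (M / N) • memoryRatePoint N K L (K * Nbar N K L)).2, ?_⟩
  convert h using 1
  refine Prod.ext ?_ rfl
  simp only [Prod.fst_add, Prod.smul_fst, memoryRatePoint_zero, memoryRatePoint_last hN hK hL,
    smul_eq_mul]
  field_simp
  ring

/-- A message made of `c` symbols and of a header with at most `A` values has entropy at most
`c + log A`. -/
lemma entropy_le_add_log {Ω α : Type*} [Fintype Ω] [Fintype α] [Fact q.Prime] {c A : ℕ}
    (hA : Fintype.card α ≤ A) (p : stdSimplex ℝ Ω) (X : Ω → (Fin c → ZMod q) × α) :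
    entropy q p X ≤ c + Real.log A / Real.log q := by
  obtain ⟨ω₀⟩ := nonempty_of_stdSimplex p
  have : Nonempty α := ⟨(X ω₀).2⟩
  have hq : 1 < q := (Fact.out : q.Prime).one_lt
  have hlog : 0 < Real.log q := Real.log_pos (by exact_mod_cast hq)
  have hα : (0 : ℝ) < Fintype.card α := by exact_mod_cast Fintype.card_pos
  have hq0 : (q : ℝ) ≠ 0 := by exact_mod_cast (by omega : q ≠ 0)
  refine (entropy_le_log_card hq p X).trans ?_
  rw [Fintype.card_prod, Fintype.card_fun, ZMod.card, Fintype.card_fin, Nat.cast_mul,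
    Nat.cast_pow, Real.log_mul (pow_ne_zero _ hq0) hα.ne', Real.log_pow, add_div,
    mul_div_cancel_right₀ _ hlog.ne']
  gcongr

end MemorySharing

end CodedCaching

open CodedCaching in
theorem theorem1 (q : ℕ) [Fact q.Prime] (N K L : ℕ) (hN : 0 < N) (hK : 0 < K) (hL : 0 < L)
    (hLN : L ≤ N) (M : ℝ) (hM : M ∈ Set.Icc (0 : ℝ) (N : ℝ)) :
    Achievable q N K L M
      (lowerConvexEnvelope
        {x : ℝ × ℝ | ∃ r ∈ Finset.Icc 0 (K * Nbar N K L), x = memoryRatePoint N K L r} M) := by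
  intro ε hε
  unfold lowerConvexEnvelope
  obtain ⟨R', hR', hlt⟩ := exists_lt_of_csInf_lt (exists_mem_convexHull hN hK hL hM)
    (lt_add_of_pos_right _ (half_pos hε))
  set R := sInf {R : ℝ | (M, R) ∈ convexHull ℝ
    {x : ℝ × ℝ | ∃ r ∈ Finset.Icc 0 (K * Nbar N K L), x = memoryRatePoint N K L r}}
  obtain ⟨B, hB, hcode⟩ := exists_code_of_mem_convexHull (q := q) hK hR'
  have hq : 1 < q := (Fact.out : q.Prime).one_lt
  set A : ℕ := N.factorial ^ K
  set H : ℝ := Real.log A / Real.log q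
  have hH : 0 ≤ H := div_nonneg (Real.log_natCast_nonneg _) (Real.log_natCast_nonneg _)
  obtain ⟨F₀, hF₀⟩ := exists_nat_ge (max ((A : ℝ) / ε) ((B + H) / (ε / 2)))
  refine ⟨F₀ + 1, fun F hF => ?_⟩
  have hF1 : ((F₀ : ℝ) + 1) ≤ F := by exact_mod_cast hF
  have hFpos : (0 : ℝ) < F := by
    have : (0 : ℝ) ≤ F₀ := Nat.cast_nonneg _
    linarith
  have hAF : (A : ℝ) ≤ ε * F := by
    have h : (A : ℝ) / ε ≤ F := by linarith [le_max_left ((A : ℝ) / ε) ((B + H) / (ε / 2))]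
    rw [div_le_iff₀ hε] at h
    linarith
  have hBF : B + H ≤ ε / 2 * F := by
    have h : (B + H) / (ε / 2) ≤ F := by
      linarith [le_max_right ((A : ℝ) / ε) ((B + H) / (ε / 2))]
    rw [div_le_iff₀ (half_pos hε)] at h
    linarith
  obtain ⟨c, b, hc, hb, hlin⟩ := hcode F
  obtain ⟨𝒮, hcor, hpriv, hS, hJ⟩ := exists_private_scheme hK (min_le_left _ _) le_rfl
    (le_Nbar hK hLN) hlin
  have hRF : R' * F ≤ (R + ε / 2) * F := mul_le_mul_of_nonneg_right hlt.le hFpos.le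
  have hεF : 0 < ε * F := mul_pos hε hFpos
  dsimp only at hc hb
  refine ⟨c, b, 𝒮, hcor, hpriv, ⟨by linarith, by linarith, fun k => ?_, fun D => ?_⟩,
    fun k => ?_, ?_⟩
  · rw [div_le_iff₀ hFpos]
    have := entropy_le_add_log (hS k) 𝒮.law (𝒮.cache k)
    linarith
  · rw [div_le_iff₀ hFpos]
    have := entropy_le_add_log hJ 𝒮.law (𝒮.broadcast D)
    linarith
  · exact (Nat.cast_le.2 (hS k)).trans hAF
  · exact (Nat.cast_le.2 hJ).trans hAF
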